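/- Let $p$ be a prime and let $\Delta$ be a finite set. Put $E_\Delta^+ := \mathbb{F}_p[[X_\alpha \mid \alpha\in\Delta]]$, $X_\Delta := \prod_{\alpha\in\Delta} X_\alpha$ and $E_\Delta := E_\Delta^+[X_\Delta^{-1}]$. For each $\alpha\in\Delta$ let $\Gamma_\alpha$ be a copy of $\mathbb{Z}_p^\times$, with identification $\chi_\alpha\colon \Gamma_\alpha \xrightarrow{\sim} \mathbb{Z}_p^\times$, and let $T_{+,\Delta} := \prod_{\alpha\in\Delta}\varphi_\alpha^{\mathbb{N}}\Gamma_\alpha$, a commutative monoid. It acts on $E_\Delta$ by ring endomorphisms: $\varphi_\alpha$ and $\gamma_\alpha\in\Gamma_\alpha$ are induced by the continuous endomorphisms of $E_\Delta^+$ fixing $X_\beta$ for $\beta\neq\alpha$ and with $$\varphi_\alpha(X_\alpha) = (1+X_\alpha)^p-1 = X_\alpha^p, \qquad \gamma_\alpha(X_\alpha) = (1+X_\alpha)^{\chi_\alpha(\gamma_\alpha)}-1 .$$ Write $\varphi_t$ for the action of $t\in T_{+,\Delta}$. An étale $(\varphi_\Delta,\Gamma_\Delta)$-module over $E_\Delta$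 is a finitely generated $E_\Delta$-module $D$ with a semilinear action of the monoid $T_{+,\Delta}$ (each $t$ acts additively on $D$, by a map again denoted $\varphi_t$, with $\varphi_t(fd)=\varphi_t(f)\varphi_t(d)$ for $f\in E_\Delta$, $d\in D$) such that for every $t\in T_{+,\Delta}$ the map $\mathrm{id}\otimes\varphi_t\colon E_\Delta\otimes_{E_\Delta,\varphi_t} D\to D$, $f\otimes d\mapsto f\varphi_t(d)$, is an isomorphism. Then every étale $(\varphi_\Delta,\Gamma_\Delta)$-module over $E_\Delta$ is a projective $E_\Delta$-module. -/

import Mathlib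

namespace PhiGamma

noncomputable section

section OneVariable

variable (p : ℕ) [Fact p.Prime]

/-- The binomial power series `(1 + X) ^ a = ∑ n, (a choose n) X ^ n` over `𝔽_p`, for `a ∈ ℤ_p`. -/
def onePlusPow (a : ℤ_[p]) : PowerSeries (ZMod p) :=
  (PowerSeries.binomialSeries ℤ_[p] a).map PadicInt.toZMod

/-- The power series `(1 + X) ^ a - 1` over `𝔽_p`, for `a ∈ ℤ_p`. -/
def onePlusPowSubOne (a : ℤ_[p]) : PowerSeries (ZMod p) :=
  onePlusPow p a - 1

theorem coeff_onePlusPow (a : ℤ_[p]) (n : ℕ) :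
    PowerSeries.coeff n (onePlusPow p a) = PadicInt.toZMod (Ring.choose a n) := by
  simp [onePlusPow]

theorem constantCoeff_onePlusPowSubOne (a : ℤ_[p]) :
    PowerSeries.constantCoeff (onePlusPowSubOne p a) = 0 := by
  rw [onePlusPowSubOne, map_sub, ← PowerSeries.coeff_zero_eq_constantCoeff_apply,
    coeff_onePlusPow]
  simp

theorem hasSubst_onePlusPowSubOne (a : ℤ_[p]) :
    PowerSeries.HasSubst (onePlusPowSubOne p a) :=
  PowerSeries.HasSubst.of_constantCoeff_zero' (constantCoeff_onePlusPowSubOne p a)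

theorem onePlusPow_natCast (n : ℕ) :
    onePlusPow p (n : ℤ_[p]) = (1 + PowerSeries.X) ^ n := by
  simp [onePlusPow]

theorem onePlusPow_mul_natCast (a : ℤ_[p]) (n : ℕ) :
    onePlusPow p (a * n) = onePlusPow p a ^ n := by
  induction n with
  | zero => simp [onePlusPow]
  | succ n ih =>
    rw [pow_succ, ← ih]
    simp only [Nat.cast_succ, mul_add, mul_one, onePlusPow, PowerSeries.binomialSeries_add,
      map_mul]

theorem onePlusPowSubOne_one : onePlusPowSubOne p 1 = PowerSeries.X := by
  have h := onePlusPow_natCast p 1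
  rw [Nat.cast_one, pow_one] at h
  rw [onePlusPowSubOne, h, add_sub_cancel_left]

/-- Two elements of `ℤ_p` close to each other have the same reduction. -/
theorem toZMod_eq_of_dist_lt {x y : ℤ_[p]} (h : dist x y < 1) :
    PadicInt.toZMod x = PadicInt.toZMod y := by
  rw [← sub_eq_zero, ← map_sub, ← RingHom.mem_ker, PadicInt.ker_toZMod,
    IsLocalRing.mem_maximalIdeal, PadicInt.mem_nonunits]
  rwa [dist_eq_norm] at h

theorem isLocallyConstant_toZMod_choose (n : ℕ) :
    IsLocallyConstant (fun a : ℤ_[p] => PadicInt.toZMod (Ring.choose a n)) := by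
  rw [IsLocallyConstant.iff_eventually_eq]
  intro a
  have h := (PadicInt.continuous_choose (p := p) n).continuousAt (x := a)
  filter_upwards [h (Metric.ball_mem_nhds _ one_pos)] with b hb
  exact toZMod_eq_of_dist_lt p hb

/-- `((1 + X) ^ a) ^ b = (1 + X) ^ (a * b)`. -/
theorem subst_onePlusPow (a b : ℤ_[p]) :
    (onePlusPow p b).subst (onePlusPowSubOne p a) = onePlusPow p (a * b) := by
  have hs := hasSubst_onePlusPowSubOne p a
  ext n
  have key : ∀ b : ℤ_[p],
      PowerSeries.coeff n ((onePlusPow p b).subst (onePlusPowSubOne p a)) =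
        ∑ k ∈ Finset.range (n + 1),
          PadicInt.toZMod (Ring.choose b k) *
            PowerSeries.coeff n (onePlusPowSubOne p a ^ k) := by
    intro b
    rw [PowerSeries.coeff_subst' hs,
      finsum_eq_sum_of_support_subset (s := Finset.range (n + 1))]
    · simp [coeff_onePlusPow]
    · intro k hk
      rw [Function.mem_support] at hk
      by_contra hkn
      apply hk
      have hX : (PowerSeries.X : PowerSeries (ZMod p)) ^ k ∣ onePlusPowSubOne p a ^ k :=
        pow_dvd_pow_of_dvd
          (PowerSeries.X_dvd_iff.mpr (constantCoeff_onePlusPowSubOne p a)) k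
      rw [PowerSeries.X_pow_dvd_iff.mp hX n (by simpa using hkn), smul_zero]
  let _ : TopologicalSpace (ZMod p) := ⊥
  have _ : DiscreteTopology (ZMod p) := ⟨rfl⟩
  have hF : Continuous fun b : ℤ_[p] =>
      ∑ k ∈ Finset.range (n + 1), PadicInt.toZMod (Ring.choose b k) *
        PowerSeries.coeff n (onePlusPowSubOne p a ^ k) :=
    continuous_finsetSum _ fun k _ =>
      (isLocallyConstant_toZMod_choose p k).continuous.mul continuous_const
  have hH : Continuous fun b : ℤ_[p] => PowerSeries.coeff n (onePlusPow p (a * b)) := by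
    simp only [coeff_onePlusPow]
    exact (isLocallyConstant_toZMod_choose p n).continuous.comp (continuous_const.mul continuous_id)
  simp only [← key] at hF
  refine congrFun (PadicInt.denseRange_natCast.equalizer hF hH (funext fun m => ?_)) b
  have hm : (onePlusPow p (m : ℤ_[p])).subst (onePlusPowSubOne p a) =
      onePlusPow p (a * (m : ℤ_[p])) := by
    rw [onePlusPow_natCast, onePlusPow_mul_natCast, PowerSeries.subst_pow hs,
      PowerSeries.subst_add hs, PowerSeries.subst_X hs, ← PowerSeries.coe_substAlgHom hs, map_one,
      onePlusPowSubOne, add_sub_cancel]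
  exact congrArg (PowerSeries.coeff n) hm

theorem subst_onePlusPowSubOne (a b : ℤ_[p]) :
    (onePlusPowSubOne p b).subst (onePlusPowSubOne p a) = onePlusPowSubOne p (a * b) := by
  have hs := hasSubst_onePlusPowSubOne p a
  rw [show onePlusPowSubOne p b = onePlusPow p b - 1 from rfl, PowerSeries.subst_sub hs,
    subst_onePlusPow]
  rw [← PowerSeries.coe_substAlgHom hs, map_one, onePlusPowSubOne]

/-- `(1 + X) ^ (u p ^ n) - 1` is a unit times a power of `X` if `u ∈ ℤ_p^×`. -/
theorem exists_onePlusPowSubOne_eq (n : ℕ) (u : ℤ_[p]ˣ) :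
    ∃ w : (PowerSeries (ZMod p))ˣ,
      onePlusPowSubOne p ((p : ℤ_[p]) ^ n * u) =
        (w : PowerSeries (ZMod p)) * PowerSeries.X ^ (p ^ n) := by
  obtain ⟨g, hg⟩ := PowerSeries.X_dvd_iff.mpr (constantCoeff_onePlusPowSubOne p (u : ℤ_[p]))
  have hgu : IsUnit g := by
    rw [PowerSeries.isUnit_iff_constantCoeff]
    have h1 : PowerSeries.coeff 1 (onePlusPowSubOne p (u : ℤ_[p])) =
        PowerSeries.constantCoeff g := by
      rw [hg, ← PowerSeries.coeff_zero_eq_constantCoeff_apply]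
      simp
    rw [← h1]
    have h2 : PowerSeries.coeff 1 (onePlusPowSubOne p (u : ℤ_[p])) =
        PadicInt.toZMod (u : ℤ_[p]) := by
      simp [onePlusPowSubOne, coeff_onePlusPow, PowerSeries.coeff_one]
    rw [h2]
    exact u.isUnit.map _
  obtain ⟨w, rfl⟩ := hgu
  refine ⟨w ^ (p ^ n), ?_⟩
  have _ : CharP (PowerSeries (ZMod p)) p :=
    charP_of_injective_algebraMap (R := ZMod p) (PowerSeries.C_injective) p
  have h3 : onePlusPow p ((p : ℤ_[p]) ^ n * u) = onePlusPow p (u : ℤ_[p]) ^ (p ^ n) := by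
    rw [← onePlusPow_mul_natCast]
    push_cast
    rw [mul_comm]
  rw [onePlusPowSubOne, h3]
  have h4 : onePlusPow p (u : ℤ_[p]) ^ (p ^ n) - 1 = (onePlusPow p (u : ℤ_[p]) - 1) ^ (p ^ n) := by
    rw [sub_pow_char_pow, one_pow]
  rw [h4]
  have h5 : onePlusPow p (u : ℤ_[p]) - 1 = PowerSeries.X * (w : PowerSeries (ZMod p)) := hg
  rw [h5, mul_pow, mul_comm]
  simp

end OneVariable

section Ring

variable (p : ℕ) [Fact p.Prime] (Δ : Type*) [Fintype Δ]

/-- The power series ring `E_Δ^+ = 𝔽_p[[X_α | α ∈ Δ]]`. -/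
abbrev EPlus : Type _ := MvPowerSeries Δ (ZMod p)

/-- The element `X_Δ = ∏ α, X_α` of `E_Δ^+`. -/
def XDelta : EPlus p Δ := ∏ α : Δ, MvPowerSeries.X α

/-- The Laurent series ring `E_Δ = E_Δ^+[X_Δ⁻¹]`. -/
abbrev E : Type _ := Localization.Away (XDelta p Δ)

/-- The commutative monoid `T_{+,Δ} = ∏ α, φ_α^ℕ Γ_α`, where `Γ_α` is identified with `ℤ_p^×`
by means of `χ_α`. The element `φ_α^n γ_α` is the pair `(n, χ_α(γ_α))`. -/
abbrev TPlus : Type _ := Δ → Multiplicative ℕ × ℤ_[p]ˣ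

/-- `φ_α^n γ_α ↦ p ^ n * χ_α(γ_α)`. -/
def exponent : Multiplicative ℕ × ℤ_[p]ˣ →* ℤ_[p] where
  toFun x := (p : ℤ_[p]) ^ (Multiplicative.toAdd x.1) * (x.2 : ℤ_[p])
  map_one' := by simp
  map_mul' x y := by simp [pow_add]; ring

variable {Δ}

/-- The image of the variable `X_α` under `φ_t` for `t = ∏ α, φ_α^{n_α} γ_α`, i.e.
`(1 + X_α) ^ (p ^ n_α * χ_α(γ_α)) - 1`. -/
def phiVar (t : TPlus p Δ) (α : Δ) : EPlus p Δ :=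
  (onePlusPowSubOne p (exponent p (t α))).subst (MvPowerSeries.X α : EPlus p Δ)

theorem constantCoeff_phiVar (t : TPlus p Δ) (α : Δ) :
    MvPowerSeries.constantCoeff (phiVar p t α) = 0 :=
  PowerSeries.constantCoeff_subst_eq_zero (MvPowerSeries.constantCoeff_X α) _
    (constantCoeff_onePlusPowSubOne p _)

theorem hasSubst_phiVar (t : TPlus p Δ) : MvPowerSeries.HasSubst (phiVar p t) :=
  MvPowerSeries.hasSubst_of_constantCoeff_zero (constantCoeff_phiVar p t)

/-- The continuous endomorphism of `E_Δ^+` with `X_α ↦ (1 + X_α) ^ (p ^ n_α * χ_α(γ_α)) - 1` for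
all `α`, for `t = ∏ α, φ_α^{n_α} γ_α`. -/
def phiPlus (t : TPlus p Δ) : EPlus p Δ →+* EPlus p Δ :=
  (MvPowerSeries.substAlgHom (R := ZMod p) (hasSubst_phiVar p t)).toRingHom

theorem phiPlus_apply (t : TPlus p Δ) (f : EPlus p Δ) :
    phiPlus p t f = MvPowerSeries.subst (phiVar p t) f :=
  MvPowerSeries.substAlgHom_apply (hasSubst_phiVar p t) f

theorem phiPlus_X (t : TPlus p Δ) (α : Δ) :
    phiPlus p t (MvPowerSeries.X α) = phiVar p t α := by
  rw [phiPlus_apply, MvPowerSeries.subst_X (hasSubst_phiVar p t)]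

theorem phiPlus_one : phiPlus p (1 : TPlus p Δ) = RingHom.id _ := by
  have h : phiVar p (1 : TPlus p Δ) = MvPowerSeries.X := by
    funext α
    rw [phiVar, Pi.one_apply, map_one, onePlusPowSubOne_one,
      PowerSeries.subst_X (PowerSeries.HasSubst.X α)]
  ext1 f
  rw [phiPlus_apply, h, MvPowerSeries.subst_self]
  rfl

theorem phiPlus_mul (s t : TPlus p Δ) :
    phiPlus p (s * t) = (phiPlus p s).comp (phiPlus p t) := by
  have h : ∀ α, phiVar p (s * t) α = MvPowerSeries.subst (phiVar p s) (phiVar p t α) := by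
    intro α
    have hX : PowerSeries.HasSubst (MvPowerSeries.X α : EPlus p Δ) := PowerSeries.HasSubst.X α
    have h1 : MvPowerSeries.subst (phiVar p s) (phiVar p t α) =
        (onePlusPowSubOne p (exponent p (t α))).subst (phiVar p s α) := by
      rw [phiVar, PowerSeries.subst_def, PowerSeries.subst_def,
        MvPowerSeries.subst_comp_subst_apply hX.const (hasSubst_phiVar p s)]
      congr 1
      funext _
      exact MvPowerSeries.subst_X (hasSubst_phiVar p s) α
    rw [h1]
    conv_rhs => rw [phiVar]
    rw [← PowerSeries.subst_comp_subst_apply (hasSubst_onePlusPowSubOne p _) hX,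
      subst_onePlusPowSubOne, ← map_mul]
    rfl
  ext1 f
  rw [RingHom.comp_apply, phiPlus_apply, phiPlus_apply, phiPlus_apply,
    MvPowerSeries.subst_comp_subst_apply (hasSubst_phiVar p t) (hasSubst_phiVar p s)]
  congr 1
  funext α
  exact h α

/-- `φ_t(X_Δ)` is invertible in `E_Δ`. -/
theorem isUnit_phiPlus_XDelta (t : TPlus p Δ) :
    IsUnit (algebraMap (EPlus p Δ) (E p Δ) (phiPlus p t (XDelta p Δ))) := by
  have hX : ∀ α : Δ, IsUnit (algebraMap (EPlus p Δ) (E p Δ) (MvPowerSeries.X α)) := by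
    intro α
    have h := IsLocalization.Away.algebraMap_isUnit (S := E p Δ) (XDelta p Δ)
    exact isUnit_of_dvd_unit (map_dvd _ (Finset.dvd_prod_of_mem _ (Finset.mem_univ α))) h
  have hXD : phiPlus p t (XDelta p Δ) = ∏ α : Δ, phiPlus p t (MvPowerSeries.X α) :=
    map_prod _ _ _
  rw [hXD, map_prod]
  refine IsUnit.prod_univ_iff.mpr fun α => ?_
  rw [phiPlus_X, phiVar]
  obtain ⟨w, hw⟩ := exists_onePlusPowSubOne_eq p (Multiplicative.toAdd (t α).1) (t α).2
  have hs : PowerSeries.HasSubst (MvPowerSeries.X α : EPlus p Δ) := PowerSeries.HasSubst.X α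
  change IsUnit (algebraMap _ _ (PowerSeries.subst _
    (onePlusPowSubOne p ((p : ℤ_[p]) ^ (Multiplicative.toAdd (t α).1) * ((t α).2 : ℤ_[p])))))
  rw [hw, PowerSeries.subst_mul hs, PowerSeries.subst_pow hs, PowerSeries.subst_X hs,
    map_mul, map_pow]
  refine IsUnit.mul ?_ ((hX α).pow _)
  rw [← PowerSeries.coe_substAlgHom hs]
  exact (w.isUnit.map (PowerSeries.substAlgHom (R := ZMod p) hs)).map _

/-- The endomorphism `φ_t` of `E_Δ`, extending `phiPlus p t` from `E_Δ^+`. -/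
def phiHom (t : TPlus p Δ) : E p Δ →+* E p Δ :=
  IsLocalization.Away.lift (XDelta p Δ)
    (g := (algebraMap (EPlus p Δ) (E p Δ)).comp (phiPlus p t)) (isUnit_phiPlus_XDelta p t)

theorem phiHom_algebraMap (t : TPlus p Δ) (f : EPlus p Δ) :
    phiHom p t (algebraMap (EPlus p Δ) (E p Δ) f) =
      algebraMap (EPlus p Δ) (E p Δ) (phiPlus p t f) :=
  IsLocalization.Away.lift_eq _ _ _

/-- The action `t ↦ φ_t` of the monoid `T_{+,Δ}` on the ring `E_Δ`. -/
def phi : TPlus p Δ →* (E p Δ →+* E p Δ) where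
  toFun := phiHom p
  map_one' := by
    refine IsLocalization.ringHom_ext (Submonoid.powers (XDelta p Δ)) (RingHom.ext fun f => ?_)
    rw [RingHom.comp_apply, phiHom_algebraMap, phiPlus_one]
    rfl
  map_mul' s t := by
    refine IsLocalization.ringHom_ext (Submonoid.powers (XDelta p Δ)) (RingHom.ext fun f => ?_)
    rw [RingHom.comp_apply, phiHom_algebraMap, phiPlus_mul, RingHom.comp_apply, RingHom.comp_apply,
      RingHom.mul_def, RingHom.comp_apply, phiHom_algebraMap, phiHom_algebraMap]

end Ring

section Linearization

variable {R : Type*} [CommRing R]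

/-- The ring `R`, regarded as an `R`-algebra by means of the endomorphism `φ`. -/
def Twist (_φ : R →+* R) : Type _ := R

instance (φ : R →+* R) : CommRing (Twist φ) := inferInstanceAs (CommRing R)

instance (φ : R →+* R) : Algebra R (Twist φ) := RingHom.toAlgebra (S := Twist φ) φ

/-- The identity map from `Twist φ` to `R`, as a ring isomorphism. -/
def Twist.equiv (φ : R →+* R) : Twist φ ≃+* R := RingEquiv.refl R

theorem Twist.equiv_algebraMap (φ : R →+* R) (r : R) :
    Twist.equiv φ (algebraMap R (Twist φ) r) = φ r :=
  rfl

/-- The additive map underlying `linearization`. -/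
def linearizationAddHom (φ : R →+* R) {M : Type*} [AddCommGroup M] [Module R M]
    (f : M →ₛₗ[φ] M) : TensorProduct R (Twist φ) M →+ M :=
  TensorProduct.liftAddHom
    ((AddMonoidHom.compHom.flip f.toAddMonoidHom).comp
      ((Module.toAddMonoidEnd R M).comp (Twist.equiv φ).toRingHom).toAddMonoidHom)
    (fun r a m => by
      change (φ r * Twist.equiv φ a) • f m = Twist.equiv φ a • f (r • m)
      rw [f.map_smulₛₗ, smul_smul, mul_comm])

/-- For a `φ`-semilinear endomorphism `f` of an `R`-module `M`, the `R`-linear map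
`id ⊗ f : φ^* M = R ⊗_{R,φ} M → M`, `a ⊗ m ↦ a f(m)`. The left factor of the tensor product
is `R`, with `R` acting on it through `φ` in the formation of the tensor product, and the linearity
is with respect to multiplication by `R` on the left factor. -/
def linearization (φ : R →+* R) {M : Type*} [AddCommGroup M] [Module R M] (f : M →ₛₗ[φ] M) :
    TensorProduct R (Twist φ) M →ₛₗ[(Twist.equiv φ).toRingHom] M where
  toFun := linearizationAddHom φ f
  map_add' := map_add _
  map_smul' b x := by
    induction x with
    | zero => rw [smul_zero, map_zero, smul_zero]
    | add x y hx hy => rw [smul_add, map_add, hx, hy, map_add, smul_add]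
    | tmul a m => exact mul_smul (Twist.equiv φ b) (Twist.equiv φ a) (f m)

theorem linearization_tmul (φ : R →+* R) {M : Type*} [AddCommGroup M] [Module R M]
    (f : M →ₛₗ[φ] M) (a : Twist φ) (m : M) :
    linearization φ f (TensorProduct.tmul R a m) = Twist.equiv φ a • f m :=
  rfl

end Linearization

section Modules

variable (p : ℕ) [Fact p.Prime] (Δ : Type*) [Fintype Δ]
  (D : Type*) [AddCommGroup D] [Module (E p Δ) D] [DistribMulAction (TPlus p Δ) D]

/-- The additive action of `T_{+,Δ}` on the `E_Δ`-module `D` is semilinear. -/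
def IsSemilinearAction : Prop :=
  ∀ (t : TPlus p Δ) (f : E p Δ) (d : D), t • (f • d) = phi p t f • (t • d)

variable {p Δ D}

/-- The action of `t ∈ T_{+,Δ}` on `D` as a `φ_t`-semilinear map. -/
def IsSemilinearAction.map (h : IsSemilinearAction p Δ D) (t : TPlus p Δ) : D →ₛₗ[phi p t] D where
  toFun d := t • d
  map_add' := smul_add t
  map_smul' := h t

variable (p Δ D)

/-- An étale `(φ_Δ, Γ_Δ)`-module over `E_Δ`: a finitely generated `E_Δ`-module `D` with a semilinear
action of the monoid `T_{+,Δ}` such that `id ⊗ φ_t : φ_t^* D → D` is an isomorphism for all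
`t ∈ T_{+,Δ}`. -/
structure IsEtalePhiGammaModule : Prop where
  finite : Module.Finite (E p Δ) D
  semilinear : IsSemilinearAction p Δ D
  etale : ∀ t : TPlus p Δ, Function.Bijective (linearization (phi p t) (semilinear.map t))

end Modules

end

end PhiGamma

/-! ### Relations between generators and semilinear maps -/

namespace PhiGamma

section Presentation

variable {R S : Type*} [CommRing R] [CommRing S] {ι κ : Type*}

/-- Coordinatewise application of a ring homomorphism commutes with passing to the span. -/
theorem span_image_comp_span (σ : R →+* S) (T : Set (ι → R)) :
    Submodule.span S ((fun v : ι → R => σ ∘ v) '' (Submodule.span R T : Set (ι → R))) =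
      Submodule.span S ((fun v : ι → R => σ ∘ v) '' T) := by
  refine le_antisymm (Submodule.span_le.mpr ?_)
    (Submodule.span_mono (Set.image_mono Submodule.subset_span))
  rintro _ ⟨v, hv, rfl⟩
  simp only [SetLike.mem_coe] at hv ⊢
  induction hv using Submodule.span_induction with
  | mem x hx => exact Submodule.subset_span ⟨x, hx, rfl⟩
  | zero =>
    have h : (σ ∘ (0 : ι → R)) = 0 := by ext; simp
    rw [h]
    exact zero_mem _
  | add x y _ _ hx hy =>
    have h : (σ ∘ (x + y)) = σ ∘ x + σ ∘ y := by ext; simp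
    rw [h]
    exact add_mem hx hy
  | smul a x _ hx =>
    have h : (σ ∘ (a • x)) = σ a • (σ ∘ x) := by ext; simp
    rw [h]
    exact Submodule.smul_mem _ _ hx

variable [Fintype ι] {M : Type*} [AddCommGroup M] [Module R M]

/-- The submodule of relations between the elements of a finite family. -/
abbrev relations (R : Type*) [CommRing R] {M : Type*} [AddCommGroup M] [Module R M]
    {ι : Type*} [Fintype ι] (d : ι → M) : Submodule R (ι → R) :=
  LinearMap.ker (Fintype.linearCombination R d)

theorem mem_relations {d : ι → M} {v : ι → R} :
    v ∈ relations R d ↔ Fintype.linearCombination R d v = 0 :=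
  Iff.rfl

section BaseChange

variable [Algebra R S] {N : Type*} [AddCommGroup N] [Module R N] [Module S N]
  [IsScalarTower R S N] {g : M →ₗ[R] N}

theorem linearCombination_comp_algebraMap (g : M →ₗ[R] N) (d : ι → M) (v : ι → R) :
    Fintype.linearCombination S (g ∘ d) (algebraMap R S ∘ v) =
      g (Fintype.linearCombination R d v) := by
  simp [Fintype.linearCombination_apply]

theorem span_range_comp_of_isBaseChange (hg : IsBaseChange S g) {d : ι → M}
    (hd : Submodule.span R (Set.range d) = ⊤) : Submodule.span S (Set.range (g ∘ d)) = ⊤ := by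
  rw [← Fintype.range_linearCombination] at hd ⊢
  rw [LinearMap.range_eq_top] at hd
  rw [eq_top_iff]
  rintro x -
  induction x using hg.inductionOn with
  | zero => exact zero_mem _
  | tmul m =>
    obtain ⟨v, rfl⟩ := hd m
    exact ⟨_, linearCombination_comp_algebraMap g d v⟩
  | smul s n hn => exact Submodule.smul_mem _ _ hn
  | add x y hx hy => exact add_mem hx hy

/-- The relations between generators after a base change are spanned by the original relations. -/
theorem relations_comp_of_isBaseChange (hg : IsBaseChange S g) {d : ι → M}
    (hd : Submodule.span R (Set.range d) = ⊤) :
    relations S (g ∘ d) =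
      Submodule.span S ((fun v : ι → R => algebraMap R S ∘ v) '' (relations R d : Set (ι → R))) := by
  classical
  set K := Submodule.span S
    ((fun v : ι → R => algebraMap R S ∘ v) '' (relations R d : Set (ι → R))) with hK
  rw [← Fintype.range_linearCombination, LinearMap.range_eq_top] at hd
  refine le_antisymm ?_ (Submodule.span_le.mpr ?_)
  · let q : (ι → R) →ₗ[R] ((ι → S) ⧸ K) :=
      (K.mkQ.restrictScalars R).comp ((Algebra.linearMap R S).compLeft ι)
    have hq : relations R d ≤ LinearMap.ker q := fun v hv =>
      (Submodule.Quotient.mk_eq_zero K).mpr (Submodule.subset_span ⟨v, hv, rfl⟩)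
    let r : M →ₗ[R] ((ι → S) ⧸ K) := ((relations R d).liftQ q hq).comp
      ((Fintype.linearCombination R d).quotKerEquivOfSurjective hd).symm.toLinearMap
    have hr : ∀ i, r (d i) = K.mkQ (Pi.single i 1) := by
      intro i
      have h1 : ((Fintype.linearCombination R d).quotKerEquivOfSurjective hd).symm (d i) =
          Submodule.Quotient.mk (Pi.single i 1) := by
        rw [LinearEquiv.symm_apply_eq, LinearMap.quotKerEquivOfSurjective_apply_mk,
          Fintype.linearCombination_apply_single, one_smul]
      have h2 : (Algebra.linearMap R S).compLeft ι (Pi.single i 1) = Pi.single i 1 := by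
        ext j
        by_cases h : j = i
        · subst h; simp
        · simp [h]
      rw [LinearMap.comp_apply, LinearEquiv.coe_coe, h1]
      exact congrArg K.mkQ h2
    have key : (hg.lift r).comp (Fintype.linearCombination S (g ∘ d)) = K.mkQ := by
      ext i
      simp [Fintype.linearCombination_apply_single, hg.lift_eq, hr]
    intro a ha
    rw [← Submodule.ker_mkQ K, ← key, LinearMap.mem_ker, LinearMap.comp_apply,
      LinearMap.mem_ker.mp ha, map_zero]
  · rintro _ ⟨v, hv, rfl⟩
    change Fintype.linearCombination S (g ∘ d) (algebraMap R S ∘ v) = 0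
    rw [linearCombination_comp_algebraMap, LinearMap.mem_ker.mp hv, map_zero]

end BaseChange

/-- The families `d` and `d'` generate `M`, and the relations between the `d' i` are spanned by the
images under `φ` of the relations between the `d i`. In other words, `d i ↦ d' i` induces an
isomorphism from `φ^* M` to `M`. -/
structure IsTwistedPresentation (φ : R →+* R) (d d' : ι → M) : Prop where
  span_range : Submodule.span R (Set.range d) = ⊤
  span_range' : Submodule.span R (Set.range d') = ⊤
  relations_eq : relations R d' =
    Submodule.span R ((fun v : ι → R => φ ∘ v) '' (relations R d : Set (ι → R)))

theorem IsTwistedPresentation.baseChange [Algebra R S] {N : Type*} [AddCommGroup N] [Module R N]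
    [Module S N] [IsScalarTower R S N] {g : M →ₗ[R] N} (hg : IsBaseChange S g) {φ : R →+* R}
    {ψ : S →+* S} (hφψ : ψ.comp (algebraMap R S) = (algebraMap R S).comp φ) {d d' : ι → M}
    (h : IsTwistedPresentation φ d d') : IsTwistedPresentation ψ (g ∘ d) (g ∘ d') where
  span_range := span_range_comp_of_isBaseChange hg h.span_range
  span_range' := span_range_comp_of_isBaseChange hg h.span_range'
  relations_eq := by
    have h1 : ∀ v : ι → R, ψ ∘ (algebraMap R S ∘ v) = algebraMap R S ∘ (φ ∘ v) := fun v =>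
      funext fun i => RingHom.congr_fun hφψ (v i)
    rw [relations_comp_of_isBaseChange hg h.span_range, span_image_comp_span,
      relations_comp_of_isBaseChange hg h.span_range', h.relations_eq, span_image_comp_span,
      Set.image_image, Set.image_image]
    simp only [h1]

/-- The bijectivity of `id ⊗ f : φ^* M → M` in terms of generators and relations. -/
theorem isTwistedPresentation_of_bijective {φ : R →+* R} {f : M →ₛₗ[φ] M}
    (hf : Function.Bijective (linearization φ f)) {d : ι → M}
    (hd : Submodule.span R (Set.range d) = ⊤) : IsTwistedPresentation φ d (f ∘ d) := by
  let g : M →ₗ[R] TensorProduct R (Twist φ) M := TensorProduct.mk R (Twist φ) M 1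
  have hg : IsBaseChange (Twist φ) g := TensorProduct.isBaseChange R M (Twist φ)
  have key : ∀ v : ι → Twist φ, linearization φ f
      (Fintype.linearCombination (Twist φ) (g ∘ d) v) =
        Fintype.linearCombination R (f ∘ d) (Twist.equiv φ ∘ v) := by
    intro v
    simp only [Fintype.linearCombination_apply, map_sum]
    refine Finset.sum_congr rfl fun i _ => ?_
    rw [LinearMap.map_smulₛₗ]
    change Twist.equiv φ (v i) • linearization φ f (TensorProduct.tmul R 1 (d i)) = _
    rw [linearization_tmul, map_one, one_smul]
    rfl
  refine ⟨hd, ?_, ?_⟩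
  · rw [← Fintype.range_linearCombination, LinearMap.range_eq_top]
    intro m
    obtain ⟨x, rfl⟩ := hf.2 m
    have h1 := span_range_comp_of_isBaseChange hg hd
    rw [← Fintype.range_linearCombination, LinearMap.range_eq_top] at h1
    obtain ⟨v, rfl⟩ := h1 x
    exact ⟨_, (key v).symm⟩
  · have h1 := relations_comp_of_isBaseChange hg hd
    ext v
    have h2 : v ∈ relations R (f ∘ d) ↔
        (Twist.equiv φ).symm ∘ v ∈ relations (Twist φ) (g ∘ d) := by
      rw [LinearMap.mem_ker, LinearMap.mem_ker, ← map_eq_zero_iff _ hf.1, key]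
      rfl
    rw [h2, h1]
    exact Iff.rfl

theorem exists_matrix_of_span_range {d : ι → M} (hd : Submodule.span R (Set.range d) = ⊤)
    (e : κ → M) : ∃ A : Matrix κ ι R, ∀ k, Fintype.linearCombination R d (A k) = e k := by
  rw [← Fintype.range_linearCombination, LinearMap.range_eq_top] at hd
  choose A hA using fun k => hd (e k)
  exact ⟨Matrix.of A, hA⟩

variable [Fintype κ]

theorem linearCombination_vecMul (A : Matrix κ ι R) (d : ι → M) (v : κ → R) :
    Fintype.linearCombination R d (Matrix.vecMul v A) =
      Fintype.linearCombination R (fun k => Fintype.linearCombination R d (A k)) v := by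
  simp only [Fintype.linearCombination_apply, Matrix.vecMul, dotProduct, Finset.smul_sum,
    Finset.sum_smul, mul_smul]
  exact Finset.sum_comm

/-- Changing generators back and forth only changes a vector by twisted relations. -/
theorem vecMul_map_sub_mem {φ : R →+* R} {e : κ → M} (P : Matrix κ κ R)
    (hP : ∀ k, Fintype.linearCombination R e (P k) = e k) (v : κ → R) :
    Matrix.vecMul v (P.map φ) - v ∈
      Submodule.span R ((fun v : κ → R => φ ∘ v) '' (relations R e : Set (κ → R))) := by
  classical
  have h1 : Matrix.vecMul v (P.map φ) - v = ∑ k, v k • (φ ∘ (P k - Pi.single k 1)) := by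
    conv_lhs => rw [← Matrix.vecMul_one v, Matrix.vecMul_vecMul, one_mul, ← Matrix.vecMul_sub]
    rw [Matrix.vecMul_eq_sum]
    refine Finset.sum_congr rfl fun k _ => congrArg _ (funext fun j => ?_)
    by_cases h : j = k
    · subst h; simp
    · simp [h, Ne.symm h]
  rw [h1]
  refine Submodule.sum_mem _ fun k _ => Submodule.smul_mem _ _ (Submodule.subset_span ⟨_, ?_, rfl⟩)
  rw [SetLike.mem_coe, LinearMap.mem_ker, map_sub, hP, Fintype.linearCombination_apply_single,
    one_smul, sub_self]

/-- A twisted presentation with respect to one family of generators yields one with respect to any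
other family. -/
theorem IsTwistedPresentation.exists_of_span_range {φ : R →+* R} {d d' : ι → M}
    (h : IsTwistedPresentation φ d d') {e : κ → M} (he : Submodule.span R (Set.range e) = ⊤) :
    ∃ e' : κ → M, IsTwistedPresentation φ e e' := by
  have hd' := h.span_range'
  rw [← Fintype.range_linearCombination, LinearMap.range_eq_top] at hd'
  obtain ⟨C, hC⟩ := exists_matrix_of_span_range h.span_range e
  obtain ⟨B, hB⟩ := exists_matrix_of_span_range he d
  have hCv : ∀ v, Fintype.linearCombination R d (Matrix.vecMul v C) =
      Fintype.linearCombination R e v := fun v => by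
    rw [linearCombination_vecMul]; simp only [hC]
  have hBv : ∀ v, Fintype.linearCombination R e (Matrix.vecMul v B) =
      Fintype.linearCombination R d v := fun v => by
    rw [linearCombination_vecMul]; simp only [hB]
  let e' : κ → M := fun k => Fintype.linearCombination R d' (φ ∘ C k)
  have he'v : ∀ v, Fintype.linearCombination R e' v =
      Fintype.linearCombination R d' (Matrix.vecMul v (C.map φ)) := fun v =>
    (linearCombination_vecMul (C.map φ) d' v).symm
  have hφC : ∀ v : κ → R, Matrix.vecMul (φ ∘ v) (C.map φ) = φ ∘ Matrix.vecMul v C :=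
    fun v => funext fun j => (RingHom.map_vecMul φ C v j).symm
  have hφB : ∀ v : ι → R, Matrix.vecMul (φ ∘ v) (B.map φ) = φ ∘ Matrix.vecMul v B :=
    fun v => funext fun j => (RingHom.map_vecMul φ B v j).symm
  refine ⟨e', he, ?_, le_antisymm ?_ (Submodule.span_le.mpr ?_)⟩
  · rw [← Fintype.range_linearCombination, LinearMap.range_eq_top]
    intro m
    obtain ⟨v, rfl⟩ := hd' m
    refine ⟨Matrix.vecMul v (B.map φ), ?_⟩
    have h1 := vecMul_map_sub_mem (φ := φ) (e := d) (B * C)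
      (fun i => by
        rw [show (B * C) i = Matrix.vecMul (B i) C from rfl,
          hCv, hB]) v
    rw [← h.relations_eq, LinearMap.mem_ker, map_sub, sub_eq_zero] at h1
    rw [he'v, ← h1, Matrix.map_mul, Matrix.vecMul_vecMul]
  · intro v hv
    have h1 := vecMul_map_sub_mem (φ := φ) (e := e) (C * B)
      (fun k => by
        rw [show (C * B) k = Matrix.vecMul (C k) B from rfl,
          hBv, hC]) v
    refine (Submodule.sub_mem_iff_right _ ?_).mp h1
    rw [Matrix.map_mul, ← Matrix.vecMul_vecMul]
    rw [LinearMap.mem_ker, he'v, ← mem_relations, h.relations_eq] at hv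
    clear h1
    generalize Matrix.vecMul v (C.map φ) = w at hv ⊢
    induction hv using Submodule.span_induction with
    | mem x hx =>
      obtain ⟨k, hk, rfl⟩ := hx
      refine Submodule.subset_span ⟨Matrix.vecMul k B, ?_, (hφB k).symm⟩
      rw [SetLike.mem_coe, LinearMap.mem_ker] at hk ⊢
      rw [hBv, hk]
    | zero => rw [Matrix.zero_vecMul]; exact zero_mem _
    | add x y _ _ hx hy => rw [Matrix.add_vecMul]; exact add_mem hx hy
    | smul a x _ hx => rw [Matrix.smul_vecMul]; exact Submodule.smul_mem _ _ hx
  · rintro _ ⟨v, hv, rfl⟩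
    rw [SetLike.mem_coe, LinearMap.mem_ker] at hv ⊢
    rw [he'v, hφC, ← mem_relations, h.relations_eq]
    refine Submodule.subset_span ⟨_, ?_, rfl⟩
    rw [SetLike.mem_coe, LinearMap.mem_ker, hCv, hv]

end Presentation

section Local

variable {R : Type*} [CommRing R] [IsLocalRing R] {ι : Type*} [Fintype ι]
  {M : Type*} [AddCommGroup M] [Module R M]

/-- A matrix between two families of generators is invertible if one of the families is minimal. -/
theorem isUnit_of_relations_mem_maximalIdeal {d d' : ι → M}
    (hmin : ∀ v ∈ relations R d, ∀ i, v i ∈ IsLocalRing.maximalIdeal R)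
    (hd' : Submodule.span R (Set.range d') = ⊤) [DecidableEq ι] {A : Matrix ι ι R}
    (hA : ∀ i, Fintype.linearCombination R d (A i) = d' i) : IsUnit A := by
  obtain ⟨B, hB⟩ := exists_matrix_of_span_range hd' d
  have h1 : (B * A).map (IsLocalRing.residue R) = 1 := by
    ext i j
    have h2 : (B * A) i - Pi.single i 1 ∈ relations R d := by
      rw [LinearMap.mem_ker, map_sub, Fintype.linearCombination_apply_single, one_smul,
        show (B * A) i = Matrix.vecMul (B i) A from rfl,
        linearCombination_vecMul]
      simp only [hA, hB, sub_self]
    have h3 := hmin _ h2 j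
    rw [← IsLocalRing.residue_eq_zero_iff, Pi.sub_apply, map_sub, sub_eq_zero] at h3
    rw [Matrix.map_apply, h3, Matrix.one_apply]
    by_cases h : i = j
    · subst h; simp
    · simp [h, Ne.symm h]
  have h4 : IsUnit (B * A).det := by
    refine isUnit_of_map_unit (IsLocalRing.residue R) _ ?_
    rw [RingHom.map_det, RingHom.mapMatrix_apply, h1, Matrix.det_one]
    exact isUnit_one
  rw [Matrix.det_mul] at h4
  exact (Matrix.isUnit_iff_isUnit_det A).mpr (isUnit_of_mul_isUnit_right h4)

/-- A minimal family of generators is a basis if it has a presentation twisted by an endomorphism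
`φ` such that `φ x` is divisible by `x ^ 2`. -/
theorem IsTwistedPresentation.relations_eq_bot [IsNoetherianRing R] {φ : R →+* R}
    (hφ : ∀ x, x ^ 2 ∣ φ x) {d d' : ι → M} (h : IsTwistedPresentation φ d d')
    (hmin : ∀ v ∈ relations R d, ∀ i, v i ∈ IsLocalRing.maximalIdeal R) :
    relations R d = ⊥ := by
  classical
  obtain ⟨A, hA⟩ := exists_matrix_of_span_range h.span_range d'
  have hAu : IsUnit A :=
    isUnit_of_relations_mem_maximalIdeal hmin h.span_range' hA
  let I : Ideal R := Ideal.span {x | ∃ v ∈ relations R d, ∃ i, v i = x}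
  have hI : I ≤ I • I := by
    refine Ideal.span_le.mpr ?_
    rintro _ ⟨v, hv, i, rfl⟩
    obtain ⟨w, rfl⟩ : ∃ w, Matrix.vecMul w A = v :=
      ⟨Matrix.vecMul v A⁻¹, by
        rw [Matrix.vecMul_vecMul,
          Matrix.nonsing_inv_mul _ ((Matrix.isUnit_iff_isUnit_det _).mp hAu), Matrix.vecMul_one]⟩
    have hw : w ∈ relations R d' := by
      rw [LinearMap.mem_ker, linearCombination_vecMul] at hv
      simp only [hA] at hv
      exact hv
    have hwI : ∀ j, w j ∈ I • I := by
      rw [h.relations_eq] at hw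
      clear hv
      induction hw using Submodule.span_induction with
      | mem x hx =>
        obtain ⟨k, hk, rfl⟩ := hx
        intro j
        obtain ⟨c, hc⟩ := hφ (k j)
        have hkj : k j ∈ I := Ideal.subset_span ⟨k, hk, j, rfl⟩
        change φ (k j) ∈ _
        rw [hc, sq, smul_eq_mul]
        exact Ideal.mul_mem_right _ _ (Ideal.mul_mem_mul hkj hkj)
      | zero => exact fun j => zero_mem _
      | add x y _ _ hx hy => exact fun j => add_mem (hx j) (hy j)
      | smul a x _ hx => exact fun j => Submodule.smul_mem _ _ (hx j)
    exact Submodule.sum_mem _ fun j _ => Ideal.mul_mem_right _ _ (hwI j)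
  have hIbot : I = ⊥ := by
    refine Submodule.eq_bot_of_le_smul_of_le_jacobson_bot I I (IsNoetherian.noetherian _) hI ?_
    rw [IsLocalRing.jacobson_eq_maximalIdeal ⊥ bot_ne_top]
    refine Ideal.span_le.mpr ?_
    rintro _ ⟨v, hv, i, rfl⟩
    exact hmin v hv i
  refine (Submodule.eq_bot_iff _).mpr fun v hv => funext fun i => ?_
  have h1 : v i ∈ I := Ideal.subset_span ⟨v, hv, i, rfl⟩
  rw [hIbot] at h1
  exact h1

/-- A finite module over a local ring has a minimal family of generators. -/
theorem exists_relations_mem_maximalIdeal (R M : Type*) [CommRing R] [IsLocalRing R]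
    [AddCommGroup M] [Module R M] [Module.Finite R M] :
    ∃ (n : ℕ) (e : Fin n → M), Submodule.span R (Set.range e) = ⊤ ∧
      ∀ v ∈ relations R e, ∀ i, v i ∈ IsLocalRing.maximalIdeal R := by
  let k := IsLocalRing.ResidueField R
  let b := Module.finBasis k (TensorProduct R k M)
  obtain ⟨e, he⟩ := (TensorProduct.mk_surjective R M k Ideal.Quotient.mk_surjective).comp_left b
  refine ⟨_, e, IsLocalRing.span_eq_top_of_tmul_eq_basis e b (congrFun he), fun v hv i => ?_⟩
  have h1 : ∑ i, IsLocalRing.residue R (v i) • b i = 0 := by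
    have h2 := congrArg (TensorProduct.mk R k M 1) (LinearMap.mem_ker.mp hv)
    rw [Fintype.linearCombination_apply, map_sum, map_zero] at h2
    rw [← h2]
    refine Finset.sum_congr rfl fun j _ => ?_
    rw [map_smul, ← congrFun he j]
    exact algebraMap_smul k (v j) _
  exact (IsLocalRing.residue_eq_zero_iff _).mp
    (Fintype.linearIndependent_iff.mp b.linearIndependent _ h1 i)

/-- Over a Noetherian local ring, a module with a twisted presentation is free if `φ x` is divisible
by `x ^ 2` for all `x`. -/
theorem IsTwistedPresentation.free [IsNoetherianRing R] {φ : R →+* R}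
    (hφ : ∀ x, x ^ 2 ∣ φ x) {d d' : ι → M} (h : IsTwistedPresentation φ d d') :
    Module.Free R M := by
  have : Module.Finite R M :=
    ⟨Submodule.fg_def.mpr ⟨_, Set.finite_range d, h.span_range⟩⟩
  obtain ⟨n, e, he, hmin⟩ := exists_relations_mem_maximalIdeal R M
  obtain ⟨e', h'⟩ := h.exists_of_span_range he
  have h1 : LinearMap.ker (Fintype.linearCombination R e) = ⊥ := h'.relations_eq_bot hφ hmin
  rw [← Fintype.range_linearCombination, LinearMap.range_eq_top] at he
  exact Module.Free.of_equiv
    (LinearEquiv.ofBijective (Fintype.linearCombination R e) ⟨LinearMap.ker_eq_bot.mp h1, he⟩)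

end Local

/-- A finite module over a Noetherian ring of characteristic `p` that is isomorphic to its Frobenius
pullback is projective. -/
theorem projective_of_bijective_linearization {R M : Type*} [CommRing R] [IsNoetherianRing R]
    [AddCommGroup M] [Module R M] [Module.Finite R M] {p : ℕ} (hp : p.Prime) (hpR : (p : R) = 0)
    {φ : R →+* R} (hφ : ∀ x, φ x = x ^ p) {f : M →ₛₗ[φ] M}
    (hf : Function.Bijective (linearization φ f)) : Module.Projective R M := by
  have : Module.FinitePresentation R M := Module.finitePresentation_of_finite R M
  obtain ⟨n, d, hd⟩ := Module.Finite.exists_fin (R := R) (M := M)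
  have h := isTwistedPresentation_of_bijective hf hd
  refine Module.projective_of_localization_maximal fun I hI => ?_
  let S := Localization.AtPrime I
  have : Fact p.Prime := ⟨hp⟩
  have : CharP S p := by
    rw [CharP.charP_iff_prime_eq_zero hp, ← map_natCast (algebraMap R S), hpR, map_zero]
  have : IsNoetherianRing S := IsLocalization.isNoetherianRing I.primeCompl S inferInstance
  have hg : IsBaseChange S (LocalizedModule.mkLinearMap I.primeCompl M) :=
    IsLocalizedModule.isBaseChange I.primeCompl S _
  have hS : IsTwistedPresentation (frobenius S p) (LocalizedModule.mkLinearMap I.primeCompl M ∘ d)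
      (LocalizedModule.mkLinearMap I.primeCompl M ∘ (f ∘ d)) := by
    refine h.baseChange hg (RingHom.ext fun x => ?_)
    rw [RingHom.comp_apply, RingHom.comp_apply, hφ, map_pow, frobenius_def]
  have : Module.Free S (LocalizedModule I.primeCompl M) :=
    hS.free fun x => by rw [frobenius_def]; exact pow_dvd_pow x hp.two_le
  exact Module.Projective.of_free

/-! ### The Frobenius endomorphism of `E_Δ` -/

section Frobenius

variable (p : ℕ) [Fact p.Prime] (Δ : Type*)

/-- The element `∏ α, φ_α` of `T_{+,Δ}`. -/
noncomputable def totalFrobenius : TPlus p Δ := fun _ => (Multiplicative.ofAdd 1, 1)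

theorem onePlusPowSubOne_prime : onePlusPowSubOne p (p : ℤ_[p]) = PowerSeries.X ^ p := by
  have _ : CharP (PowerSeries (ZMod p)) p :=
    charP_of_injective_algebraMap (R := ZMod p) (PowerSeries.C_injective) p
  rw [onePlusPowSubOne, onePlusPow_natCast, add_pow_char, one_pow, add_sub_cancel_left]

variable {Δ}

theorem phiVar_totalFrobenius (α : Δ) :
    phiVar p (totalFrobenius p Δ) α = MvPowerSeries.X α ^ p := by
  have hs : PowerSeries.HasSubst (MvPowerSeries.X α : EPlus p Δ) := PowerSeries.HasSubst.X α
  have h : exponent p (totalFrobenius p Δ α) = p := by simp [exponent, totalFrobenius]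
  rw [phiVar, h, onePlusPowSubOne_prime, PowerSeries.subst_pow hs, PowerSeries.subst_X hs]

variable [Fintype Δ]

theorem phiPlus_totalFrobenius (f : EPlus p Δ) : phiPlus p (totalFrobenius p Δ) f = f ^ p := by
  have hp : p ≠ 0 := (Fact.out : p.Prime).ne_zero
  have h : phiVar p (totalFrobenius p Δ) = fun α => (MvPowerSeries.X α : EPlus p Δ) ^ p :=
    funext (phiVar_totalFrobenius p)
  rw [← MvPowerSeries.map_frobenius_expand p hp, ZMod.frobenius_zmod, MvPowerSeries.map_id,
    phiPlus_apply, h, RingHom.id_apply, MvPowerSeries.expand, MvPowerSeries.substAlgHom_apply]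

theorem natCast_E_eq_zero : (p : E p Δ) = 0 := by
  rw [← map_natCast ((algebraMap (EPlus p Δ) (E p Δ)).comp (MvPowerSeries.C (σ := Δ))),
    CharP.cast_eq_zero, map_zero]

theorem phi_totalFrobenius (x : E p Δ) : phi p (totalFrobenius p Δ) x = x ^ p := by
  obtain ⟨a, s, rfl⟩ := IsLocalization.exists_mk'_eq (Submonoid.powers (XDelta p Δ)) x
  have h : ∀ f : EPlus p Δ, phi p (totalFrobenius p Δ) (algebraMap _ (E p Δ) f) =
      algebraMap _ (E p Δ) f ^ p := fun f =>
    (phiHom_algebraMap p _ f).trans (by rw [phiPlus_totalFrobenius, map_pow])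
  have hs : IsUnit (algebraMap (EPlus p Δ) (E p Δ) s) := IsLocalization.map_units _ s
  refine (hs.pow p).mul_left_cancel ?_
  rw [← mul_pow, mul_comm _ (IsLocalization.mk' _ _ _), IsLocalization.mk'_spec, ← h, ← h,
    ← map_mul, mul_comm, IsLocalization.mk'_spec]

end Frobenius

end PhiGamma

/-- Every étale `(φ_Δ, Γ_Δ)`-module over `E_Δ` is a projective `E_Δ`-module. -/
theorem mainTheorem6 (p : ℕ) [Fact p.Prime] (Δ : Type*) [Fintype Δ]
    (D : Type*) [AddCommGroup D] [Module (PhiGamma.E p Δ) D]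
    [DistribMulAction (PhiGamma.TPlus p Δ) D]
    (hD : PhiGamma.IsEtalePhiGammaModule p Δ D) :
    Module.Projective (PhiGamma.E p Δ) D := by
  have := hD.finite
  have : IsNoetherianRing (PhiGamma.E p Δ) :=
    IsLocalization.isNoetherianRing (Submonoid.powers (PhiGamma.XDelta p Δ)) _ inferInstance
  exact PhiGamma.projective_of_bijective_linearization Fact.out
    (PhiGamma.natCast_E_eq_zero p) (PhiGamma.phi_totalFrobenius p)
    (hD.etale (PhiGamma.totalFrobenius p Δ))
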